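/- Let $K$ be a valued field with valuation ring $\mathcal{O}$, and let $d \geq 1$ be an integer. Call a set $X \subseteq K^d$ convex if for all $n \geq 1$, all $x_1, \ldots, x_n \in X$ and all $\alpha_1, \ldots, \alpha_n \in \mathcal{O}$ with $\alpha_1 + \cdots + \alpha_n = 1$ one has $\alpha_1 x_1 + \cdots + \alpha_n x_n \in X$, and let $\operatorname{Conv}_{K^d}$ be the family of all convex subsets of $K^d$. For a family $\mathcal{F}$ of subsets of a set $Z$, the dual family $\mathcal{F}^* = \{S_x : x \in Z\}$ consists of the sets $S_x = \{A \in \mathcal{F} : x \in A\} \subseteq \mathcal{F}$. The dual VC-dimension of $\mathcal{F}$ is the VC-dimension of $\mathcal{F}^*$, that is, the largest $k \in \mathbb{N}$ such that some $k$-element set $Y \subseteq \mathcal{F}$ satisfies $\{S_x \cap Y : x \in Z\} = \mathcal{P}(Y)$ (and $\infty$ if there is no largest such $k$). Then $\operatorname{Conv}_{K^d}$ has dual VC-dimension exactly $d$. -/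

import Mathlib

namespace ValuedConvexity

/-- A subset `X` of `K^d` is convex if it is closed under all combinations
`α₁ x₁ + ⋯ + αₙ xₙ` (`n ≥ 1`) of its points with coefficients in the valuation ring of `K` and sum
`1`. Mathlib writes valuations multiplicatively, so the valuation ring `v.integer` is
`{a | v a ≤ 1}`. -/
def IsConvex {K Γ₀ : Type*} [Field K] [LinearOrderedCommGroupWithZero Γ₀] (v : Valuation K Γ₀)
    {d : ℕ} (X : Set (Fin d → K)) : Prop :=
  ∀ (n : ℕ) (x : Fin n → Fin d → K) (α : Fin n → K), 1 ≤ n →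
    (∀ i, x i ∈ X) → (∀ i, α i ∈ v.integer) → ∑ i, α i = 1 → ∑ i, α i • x i ∈ X

/-- The family `Conv_{K^d}` of all convex subsets of `K^d`. -/
def Conv {K Γ₀ : Type*} [Field K] [LinearOrderedCommGroupWithZero Γ₀] (v : Valuation K Γ₀)
    (d : ℕ) : Set (Set (Fin d → K)) :=
  {X | IsConvex v X}

/-- The trace `{S ∩ Y | S ∈ F}` of a family of sets on a set `Y`. -/
def trace {X : Type*} (F : Set (Set X)) (Y : Set X) : Set (Set X) :=
  {T | ∃ S ∈ F, T = S ∩ Y}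

/-- `F` shatters `Y` if its trace on `Y` is the whole power set of `Y`. -/
def Shatters {X : Type*} (F : Set (Set X)) (Y : Set X) : Prop :=
  trace F Y = 𝒫 Y

/-- The VC-dimension of a family of sets: the largest size of a finite set that it shatters, and
`⊤` if it shatters arbitrarily large finite sets. -/
noncomputable def vcDim {X : Type*} (F : Set (Set X)) : ℕ∞ :=
  ⨆ (Y : Finset X) (_ : Shatters F (Y : Set X)), (Y.card : ℕ∞)

/-- The dual family of `F`: the family of subsets `S_x = {A ∈ F | x ∈ A}` of `F`, for `x ∈ X`. -/
def dualFamily {X : Type*} (F : Set (Set X)) : Set (Set F) :=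
  Set.range fun x : X => {A : F | x ∈ (A : Set X)}

/-- The dual VC-dimension of a family of sets: the VC-dimension of its dual family. -/
noncomputable def dualVCDim {X : Type*} (F : Set (Set X)) : ℕ∞ :=
  vcDim (dualFamily F)

end ValuedConvexity

namespace ValuedConvexity

/-! Upper bound: if more than `d` convex sets were shattered, take `y` in all of them and, for each
`A`, a point `x A` in all but `A`. The vectors `x A - y` are linearly dependent. Dividing a relation
by a coefficient of maximal valuation makes all coefficients integral and writes some `x A` as a
convex combination of `y` and the other points, all of which lie in `A`: a contradiction
(`exists_forall_isConvex_mem`). Lower bound: the `d` coordinate hyperplanes are shattered by 0/1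
vectors. -/

variable {K Γ₀ : Type*} [Field K] [LinearOrderedCommGroupWithZero Γ₀] {v : Valuation K Γ₀} {d : ℕ}

/-- Convex sets are closed under convex combinations indexed by any nonempty finite type. -/
theorem IsConvex.sum_mem {X : Set (Fin d → K)} (hX : IsConvex v X) {ι : Type*} [Fintype ι]
    [Nonempty ι] {x : ι → Fin d → K} {α : ι → K} (hx : ∀ i, x i ∈ X)
    (hα : ∀ i, α i ∈ v.integer) (hsum : ∑ i, α i = 1) : ∑ i, α i • x i ∈ X := by
  let e := (Fintype.equivFin ι).symm
  have h := hX (Fintype.card ι) (x ∘ e) (α ∘ e) Fintype.card_pos (fun i => hx _) (fun i => hα _)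
    (by rw [← hsum]; exact e.sum_comp α)
  rwa [← e.sum_comp fun i => α i • x i]

theorem isConvex_setOf_apply_eq_zero (v : Valuation K Γ₀) (i : Fin d) :
    IsConvex v {x : Fin d → K | x i = 0} := by
  intro n x α _ hx _ _
  simp only [Set.mem_ofPred_eq] at hx ⊢
  simp [Finset.sum_apply, hx]

theorem shatters_dualFamily_iff {X : Type*} {F : Set (Set X)} {Y : Set F} :
    Shatters (dualFamily F) Y ↔
      ∀ T ⊆ Y, ∃ x : X, ∀ A ∈ Y, x ∈ (A : Set X) ↔ A ∈ T := by
  constructor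
  · intro h T hT
    obtain ⟨_, ⟨x, rfl⟩, rfl⟩ : T ∈ trace (dualFamily F) Y := h.symm ▸ hT
    exact ⟨x, fun A hA => by simp [hA]⟩
  · intro h
    refine Set.Subset.antisymm ?_ fun T hT => ?_
    · rintro _ ⟨S, -, rfl⟩
      exact Set.inter_subset_right
    · obtain ⟨x, hx⟩ := h T hT
      refine ⟨_, ⟨x, rfl⟩, ?_⟩
      ext A
      exact ⟨fun hA => ⟨(hx A (hT hA)).2 hA, hT hA⟩, fun hA => (hx A hA.2).1 hA.1⟩

/-- Given `y` and more than `d` further points of `K^d`, one of the latter lies in every convex set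
containing `y` and all the others. -/
theorem exists_forall_isConvex_mem (v : Valuation K Γ₀) {ι : Type*} [Fintype ι]
    (hι : d < Fintype.card ι) (x : ι → Fin d → K) (y : Fin d → K) :
    ∃ i, ∀ X : Set (Fin d → K), IsConvex v X → y ∈ X → (∀ j, j ≠ i → x j ∈ X) → x i ∈ X := by
  classical
  have hdep : ¬ LinearIndependent K fun i => x i - y := fun h => by
    have := h.fintype_card_le_finrank
    rw [Module.finrank_fin_fun] at this
    omega
  obtain ⟨g, hg, k, hk⟩ := Fintype.not_linearIndependent_iff.1 hdep
  obtain ⟨i, -, hi⟩ := Finset.exists_max_image Finset.univ (fun j => v (g j)) ⟨k, Finset.mem_univ k⟩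
  have hgi : g i ≠ 0 := fun h => hk <| by
    have := hi k (Finset.mem_univ k)
    rwa [h, map_zero, le_zero_iff, Valuation.zero_iff] at this
  refine ⟨i, fun X hX hy hx => ?_⟩
  let c : ι → K := fun j => -(g j / g i)
  have hc : ∀ j, c j ∈ v.integer := fun j => by
    rw [Valuation.mem_integer_iff, Valuation.map_neg, map_div₀]
    exact div_le_one_of_le₀ (hi j (Finset.mem_univ j)) zero_le
  have hci : c i = -1 := by simp [c, hgi]
  have hsum : ∑ j, c j • (x j - y) = 0 := by
    have : ∀ j, c j • (x j - y) = (-(g i)⁻¹) • (g j • (x j - y)) := fun j => by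
      rw [smul_smul]; congr 1; simp only [c]; ring
    simp_rw [this, ← Finset.smul_sum, hg, smul_zero]
  -- The coefficient of `y`, put in place of the point `x i`, is `1 - ∑ j ≠ i, c j`.
  let s : K := -∑ j, c j
  have hs : s ∈ v.integer := neg_mem (sum_mem fun j _ => hc j)
  -- As `c i = -1`, adding `δ` makes the coefficient at `i` equal to `s` and the total equal to `1`.
  let δ : ι → K := Pi.single i (1 + s)
  have hα1 : ∑ j, (c j + δ j) = 1 := by
    rw [Finset.sum_add_distrib, Finset.sum_pi_single']
    simp [s]
  have key := @IsConvex.sum_mem K Γ₀ _ _ v d X hX ι _ ⟨i⟩ (Function.update x i y)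
    (fun j => c j + δ j)
    (fun j => by
      rcases eq_or_ne j i with rfl | h
      · simpa using hy
      · simpa [h] using hx j h)
    (fun j => by
      rcases eq_or_ne j i with rfl | h
      · simpa [δ] using add_mem (hc j) (add_mem (one_mem _) hs)
      · simpa [δ, h] using hc j) hα1
  convert key using 1
  -- On summing over `j`, the first terms vanish by the relation and the multiples of `y` cancel
  -- since `s = -∑ c j`, which leaves `x i`.
  have hxi : ∀ j, (c j + δ j) • Function.update x i y j
      = c j • (x j - y) + c j • y + Pi.single (M := fun _ => Fin d → K) i (s • y + x i) j := by
    intro j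
    rcases eq_or_ne j i with rfl | h
    · simp only [δ, Pi.single_eq_same, Function.update_self, hci]
      module
    · simp only [δ, Pi.single_eq_of_ne h, Function.update_of_ne h]
      module
  simp_rw [hxi]
  rw [Finset.sum_add_distrib, Finset.sum_add_distrib, hsum, ← Finset.sum_smul,
    Finset.sum_pi_single']
  simp only [Finset.mem_univ, if_true, s]
  module

theorem card_le_of_shatters_dualFamily_conv {Y : Finset (Conv v d)}
    (hY : Shatters (dualFamily (Conv v d)) (Y : Set (Conv v d))) : Y.card ≤ d := by
  by_contra! hd
  rw [shatters_dualFamily_iff] at hY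
  obtain ⟨y, hy⟩ := hY Y subset_rfl
  -- `x A` lies in every member of `Y` except `A`.
  choose x hx using fun A : Y => hY (Y \ {A.1}) Set.sdiff_subset
  obtain ⟨A, hA⟩ := exists_forall_isConvex_mem v (by simpa using hd) x y
  have hmem := hA A.1 A.1.2 ((hy A A.2).2 A.2) fun B hB =>
    (hx B A A.2).2 ⟨A.2, fun h => hB (Subtype.ext h.symm)⟩
  exact ((hx A A A.2).1 hmem).2 rfl

theorem exists_shatters_dualFamily_conv (v : Valuation K Γ₀) (d : ℕ) :
    ∃ Y : Finset (Conv v d), Shatters (dualFamily (Conv v d)) (Y : Set (Conv v d)) ∧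
      Y.card = d := by
  classical
  let H : Fin d → Conv v d := fun i => ⟨_, isConvex_setOf_apply_eq_zero v i⟩
  have hH : Function.Injective H := fun i j hij => by
    by_contra hne
    have h : (Pi.single i 1 : Fin d → K) ∈ (H j : Set (Fin d → K)) :=
      Pi.single_eq_of_ne (Ne.symm hne) 1
    rw [← hij] at h
    have h0 : (Pi.single i 1 : Fin d → K) i = 0 := h
    simp at h0
  refine ⟨Finset.univ.image H, ?_, by simp [Finset.card_image_of_injective _ hH]⟩
  rw [shatters_dualFamily_iff]
  intro T _
  refine ⟨fun i => if H i ∈ T then 0 else 1, fun A hA => ?_⟩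
  obtain ⟨i, -, rfl⟩ := Finset.mem_image.1 hA
  change (if H i ∈ T then (0 : K) else 1) = 0 ↔ _
  simp

end ValuedConvexity

theorem theorem4p8 {K Γ₀ : Type*} [Field K] [LinearOrderedCommGroupWithZero Γ₀]
    (v : Valuation K Γ₀) (d : ℕ) (hd : 1 ≤ d) :
    ValuedConvexity.dualVCDim (ValuedConvexity.Conv v d) = (d : ℕ∞) := by
  refine le_antisymm (iSup₂_le fun Y hY => ?_) ?_
  · exact_mod_cast ValuedConvexity.card_le_of_shatters_dualFamily_conv hY
  · obtain ⟨Y, hY, hcard⟩ := ValuedConvexity.exists_shatters_dualFamily_conv v d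
    exact le_iSup₂_of_le Y hY (by rw [hcard])
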